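/- Let $d\ge 1$ be an integer and let $p>d$ and $q>0$ be real numbers. Consider the radial problem $$(|u'|^{p-2}u')'+\frac{d-1}{r}|u'|^{p-2}u'=u^q\quad (0<r<\infty),\qquad \lim_{r\to0^+}u(r)=1,\quad \lim_{r\to\infty}u(r)=0. \tag{P}$$ A $C^1$ non-increasing solution of (P) is a non-increasing function $u\in C^1(0,\infty)$ (hence $u\ge 0$) that has the two limits in (P) and satisfies the equation in the distribution sense, that is, $$-\int_0^\infty \phi'\,r^{d-1}|u'|^{p-2}u'\,dr=\int_0^\infty \phi\,r^{d-1}u^q\,dr\qquad\text{for all }\phi\in C^1_c(0,\infty).$$ Then (P) has a $C^1$ non-increasing solution. Moreover, for every $C^1$ non-increasing solution $u$ of (P), the function $|u'|^{p-2}u'$ is differentiable on $(0,\infty)$, the equation holds at every $r>0$, and (i) $u'(r)<0$ for every $r>0$ with $u(r)>0$; (ii) the functions $r^{d-1}|u'|^p$, $r^{d-1}u^{q+1}$ and $r^{d-1}u^q$ are integrable on $(0,\infty)$, the limit below exists, and $$\int_0^\infty r^{d-1}|u'|^p\,dr+\int_0^\infty r^{d-1}u^{q+1}\,dr=\lim_{r\to0^+}r^{d-1}|u'(r)|^{p-1}=\int_0^\infty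 r^{d-1}u^q\,dr.$$ -/

import Mathlib

open Set Filter Topology MeasureTheory

/-- The flux `|u'|^{p-2} u'`, as a function of the radius. For `p > 1` it vanishes wherever `u'`
does (also when `p < 2`), which is the continuous extension of `t ↦ |t|^{p-2} t` at `0`. -/
noncomputable def pFlux (p : ℝ) (u : ℝ → ℝ) (r : ℝ) : ℝ :=
  |deriv u r| ^ (p - 2) * deriv u r

/-- `u` solves `(|u'|^{p-2} u')' + (d-1)/r |u'|^{p-2} u' = u^q` on `(0, ∞)` in the distribution
sense, in the divergence form `(r^{d-1} |u'|^{p-2} u')' = r^{d-1} u^q`, tested against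
`φ ∈ C^1_c(0, ∞)`. -/
def SolvesWeakly (d : ℕ) (p q : ℝ) (u : ℝ → ℝ) : Prop :=
  ∀ φ : ℝ → ℝ, ContDiff ℝ 1 φ → HasCompactSupport φ → tsupport φ ⊆ Ioi 0 →
    -∫ r in Ioi (0 : ℝ), deriv φ r * (r ^ (d - 1) * pFlux p u r)
      = ∫ r in Ioi (0 : ℝ), φ r * (r ^ (d - 1) * u r ^ q)

/-- `u` solves the same equation pointwise on `(0, ∞)`: the flux is differentiable, with the
derivative that the equation prescribes. -/
def SolvesPointwise (d : ℕ) (p q : ℝ) (u : ℝ → ℝ) : Prop :=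
  ∀ r : ℝ, 0 < r →
    DifferentiableAt ℝ (pFlux p u) r ∧
      deriv (pFlux p u) r + ((d : ℝ) - 1) / r * pFlux p u r = u r ^ q

/-- `C^1` non-increasing solutions of the radial problem with `u(0+) = 1` and `u(∞) = 0`.
Only the values on `(0, ∞)` matter; monotonicity and the limit at infinity force `u ≥ 0` there,
so that `u ^ q` is the usual power. -/
structure IsC1NonincreasingSolution (d : ℕ) (p q : ℝ) (u : ℝ → ℝ) : Prop where
  contDiffOn : ContDiffOn ℝ 1 u (Ioi 0)
  antitoneOn : AntitoneOn u (Ioi 0)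
  equation : SolvesWeakly d p q u
  tendsto_zero : Tendsto u (𝓝[>] 0) (𝓝 1)
  tendsto_atTop : Tendsto u atTop (𝓝 0)

/-!
Write `W = r^{d-1} |u'|^{p-1}`. The equation is the first-order system
`u' = -(W / r^{d-1})^{1/(p-1)}`, `W' = -r^{d-1} u^q`, and `t = r^μ` with `2 μ = (p - d) / (p - 1)`
turns it into an Emden–Fowler system `x' = -a y^α`, `y' = -b x^β` with the continuous
coefficients `a = t / μ` and `b = t^{d/μ - 1} / μ`.

*Existence* is by shooting on `m = y(0)`, with `x(0) = 1`. Solutions are limits of an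
order-preserving Picard iteration, hence monotone in `m`; they are unique, since the system is
Lipschitz until a component vanishes and decoupled from then on; and so they depend continuously on
`m`. A negative value of `x` and one of `y` exclude each other, the first occurs for large `m` and
the second for `m < 0`, so by connectedness some `m` admits neither. For this `m` the flux `W ≥ 0`
could not survive the loss `-W' ≥ r^{d-1} ε^q` if `u ≥ ε > 0` persisted, whence `u → 0`.

*The identities* are the equations `(-W)' = r^{d-1} u^q` and
`(-u W)' = r^{d-1} |u'|^p + r^{d-1} u^{q+1}`, integrated over `(0, ∞)`. For an arbitrary solution
the first one holds pointwise by the lemma of du Bois-Reymond, and `W → 0` at infinity because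
otherwise `|u'| ≥ c r^{-(d-1)/(p-1)}`, which is not integrable there.
-/

section WeakDerivative

variable {h k G K θ φ : ℝ → ℝ} {s : Set ℝ}

/-- `G` is the derivative of `h` on `s` in the distribution sense, tested against `C^1` functions
with compact support in `s`. -/
def HasWeakDerivOn (h G : ℝ → ℝ) (s : Set ℝ) : Prop :=
  ∀ φ : ℝ → ℝ, ContDiff ℝ 1 φ → HasCompactSupport φ → tsupport φ ⊆ s →
    -∫ r in s, deriv φ r * h r = ∫ r in s, φ r * G r

lemma setIntegral_mul_eq_integral_mul (hφs : tsupport φ ⊆ s) (h : ℝ → ℝ) :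
    ∫ x in s, φ x * h x = ∫ x, φ x * h x :=
  setIntegral_eq_integral_of_forall_compl_eq_zero fun x hx => by
    rw [image_eq_zero_of_notMem_tsupport fun hxφ => hx (hφs hxφ), zero_mul]

lemma integrable_mul_of_tsupport_subset (hs : IsOpen s) (hφ : Continuous φ)
    (hφc : HasCompactSupport φ) (hφs : tsupport φ ⊆ s) (hh : ContinuousOn h s) :
    Integrable fun x => φ x * h x :=
  ((hφ.continuousOn.mul hh).continuous_of_tsupport_subset hs
    ((tsupport_mul_subset_left (f := φ) (g := h)).trans hφs)).integrable_of_hasCompactSupport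
      hφc.mul_right

lemma HasWeakDerivOn.of_hasDerivAt (hs : IsOpen s) (hh : ∀ x ∈ s, HasDerivAt h (G x) x)
    (hG : ContinuousOn G s) : HasWeakDerivOn h G s := by
  intro φ hφ hφc hφs
  have hhc : ContinuousOn h s := fun x hx => (hh x hx).continuousAt.continuousWithinAt
  have hφ' : tsupport (deriv φ) ⊆ s := (tsupport_deriv_subset (𝕜 := ℝ)).trans hφs
  rw [setIntegral_mul_eq_integral_mul hφ', setIntegral_mul_eq_integral_mul hφs, neg_eq_iff_eq_neg]
  have hφh := integrable_mul_of_tsupport_subset hs hφ.continuous hφc hφs hhc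
  have hφG := integrable_mul_of_tsupport_subset hs hφ.continuous hφc hφs hG
  have hφ'h := integrable_mul_of_tsupport_subset hs (hφ.continuous_deriv le_rfl) hφc.deriv hφ' hhc
  simp only [mul_comm _ (h _), mul_comm _ (G _)] at hφh hφG hφ'h ⊢
  exact integral_mul_deriv_eq_deriv_mul_of_integrable (fun x hx => hh x (hφs hx))
    (fun x _ => (hφ.differentiable one_ne_zero x).hasDerivAt) hφ'h hφG hφh

lemma HasWeakDerivOn.sub (hs : IsOpen s) (hhc : ContinuousOn h s) (hGc : ContinuousOn G s)
    (hkc : ContinuousOn k s) (hKc : ContinuousOn K s) (hh : HasWeakDerivOn h G s)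
    (hk : HasWeakDerivOn k K s) : HasWeakDerivOn (h - k) (G - K) s := by
  intro φ hφ hφc hφs
  have hφ' : tsupport (deriv φ) ⊆ s := (tsupport_deriv_subset (𝕜 := ℝ)).trans hφs
  have hint {f : ℝ → ℝ} (hf : ContinuousOn f s) :=
    (integrable_mul_of_tsupport_subset hs hφ.continuous hφc hφs hf).integrableOn (s := s)
  have hint' {f : ℝ → ℝ} (hf : ContinuousOn f s) :=
    (integrable_mul_of_tsupport_subset hs (hφ.continuous_deriv le_rfl) hφc.deriv hφ'
      hf).integrableOn (s := s)
  simp only [Pi.sub_apply, mul_sub]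
  rw [integral_sub (hint hGc) (hint hKc), integral_sub (hint' hhc) (hint' hkc),
    ← hh φ hφ hφc hφs, ← hk φ hφ hφc hφs]
  ring

lemma exists_primitive_of_integral_eq_zero [s.OrdConnected] (hθ : Continuous θ)
    (hθc : HasCompactSupport θ) (hθs : tsupport θ ⊆ s) (hθ0 : ∫ x, θ x = 0) :
    ∃ φ : ℝ → ℝ, ContDiff ℝ 1 φ ∧ HasCompactSupport φ ∧ tsupport φ ⊆ s ∧ deriv φ = θ := by
  have hint : Integrable θ := hθ.integrable_of_hasCompactSupport hθc
  have hder (x : ℝ) : HasDerivAt (fun x => ∫ t in Iic x, θ t) (θ x) x := by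
    refine ((hθ.integral_hasStrictDerivAt 0 x).hasDerivAt.const_add
      (∫ t in Iic 0, θ t)).congr_of_eventuallyEq (Eventually.of_forall fun y => ?_)
    simp only [← intervalIntegral.integral_Iic_sub_Iic hint.integrableOn hint.integrableOn,
      add_sub_cancel]
  have hderiv : deriv (fun x => ∫ t in Iic x, θ t) = θ := funext fun x => (hder x).deriv
  obtain ⟨a, b, habs, hab⟩ : ∃ a b, Icc a b ⊆ s ∧ tsupport θ ⊆ Icc a b := by
    rcases (tsupport θ).eq_empty_or_nonempty with hempty | hne
    · exact ⟨1, 0, by simp, by simp [hempty]⟩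
    · obtain ⟨a, ha⟩ := hθc.isCompact.exists_isLeast hne
      obtain ⟨b, hb⟩ := hθc.isCompact.exists_isGreatest hne
      exact ⟨a, b, s.Icc_subset (hθs ha.1) (hθs hb.1), fun x hx => ⟨ha.2 hx, hb.2 hx⟩⟩
  have hzero {x : ℝ} (hx : x ∉ Icc a b) : θ x = 0 :=
    image_eq_zero_of_notMem_tsupport fun hxθ => hx (hab hxθ)
  have hsupp : Function.support (fun x => ∫ t in Iic x, θ t) ⊆ Icc a b := by
    refine Function.support_subset_iff'.2 fun x hx => ?_
    rcases lt_or_ge x a with hxa | hax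
    · exact setIntegral_eq_zero_of_forall_eq_zero fun t ht =>
        hzero fun h => (h.1.trans ht).not_gt hxa
    · rw [← hθ0]
      exact setIntegral_eq_integral_of_forall_compl_eq_zero fun t ht =>
        hzero fun h => hx ⟨hax, (lt_of_not_ge ht).le.trans h.2⟩
  exact ⟨_, contDiff_one_iff_deriv.2 ⟨fun x => (hder x).differentiableAt, by rwa [hderiv]⟩,
    HasCompactSupport.of_support_subset_isCompact isCompact_Icc hsupp,
    (closure_minimal hsupp isClosed_Icc).trans habs, hderiv⟩

lemma HasWeakDerivOn.integral_mul_eq_zero [s.OrdConnected] (hh : HasWeakDerivOn h 0 s)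
    (hθ : Continuous θ) (hθc : HasCompactSupport θ) (hθs : tsupport θ ⊆ s)
    (hθ0 : ∫ x, θ x = 0) : ∫ x, θ x * h x = 0 := by
  obtain ⟨φ, hφ, hφc, hφs, rfl⟩ := exists_primitive_of_integral_eq_zero hθ hθc hθs hθ0
  simpa [setIntegral_mul_eq_integral_mul hθs] using hh φ hφ hφc hφs

lemma exists_integral_eq_one_of_isOpen (hs : IsOpen s) (hne : s.Nonempty) :
    ∃ η : ℝ → ℝ, Continuous η ∧ HasCompactSupport η ∧ tsupport η ⊆ s ∧ ∫ x, η x = 1 := by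
  obtain ⟨x, hx⟩ := hne
  obtain ⟨ε, hε, hεs⟩ := Metric.nhds_basis_closedBall.mem_iff.1 (hs.mem_nhds hx)
  let η : ContDiffBump x := ⟨ε / 2, ε, half_pos hε, half_lt_self hε⟩
  exact ⟨η.normed volume, η.continuous_normed, η.hasCompactSupport_normed,
    η.tsupport_normed_eq.trans_subset hεs, η.integral_normed⟩

/-- The lemma of du Bois-Reymond. -/
lemma HasWeakDerivOn.exists_eqOn_const [s.OrdConnected] (hs : IsOpen s) (hhc : ContinuousOn h s)
    (hh : HasWeakDerivOn h 0 s) : ∃ c, EqOn h (fun _ => c) s := by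
  rcases s.eq_empty_or_nonempty with rfl | hne
  · exact ⟨0, eqOn_empty _ _⟩
  obtain ⟨η, hη, hηc, hηs, hη1⟩ := exists_integral_eq_one_of_isOpen hs hne
  set c := ∫ x, η x * h x with hc
  have horth (ψ : ℝ → ℝ) (hψ : Continuous ψ) (hψc : HasCompactSupport ψ) (hψs : tsupport ψ ⊆ s) :
      ∫ x, ψ x • (h x - c) = 0 := by
    have hψi : Integrable ψ := hψ.integrable_of_hasCompactSupport hψc
    have hηi : Integrable η := hη.integrable_of_hasCompactSupport hηc
    have hψh := integrable_mul_of_tsupport_subset hs hψ hψc hψs hhc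
    have hηh := integrable_mul_of_tsupport_subset hs hη hηc hηs hhc
    -- Subtracting a multiple of `η` makes the test function a derivative.
    have hzero := hh.integral_mul_eq_zero (θ := ψ - (fun _ => ∫ x, ψ x) * η)
      (hψ.sub (continuous_const.mul hη)) (hψc.sub hηc.mul_left)
      ((tsupport_sub _ _).trans (union_subset hψs ((tsupport_mul_subset_right).trans hηs)))
      (by simp only [Pi.sub_apply, Pi.mul_apply]
          rw [integral_sub hψi (hηi.const_mul _), integral_const_mul, hη1, mul_one, sub_self])
    simp only [Pi.sub_apply, Pi.mul_apply, sub_mul, mul_assoc] at hzero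
    rw [integral_sub hψh (hηh.const_mul _), integral_const_mul, ← hc] at hzero
    simp only [smul_eq_mul, mul_sub]
    rwa [integral_sub hψh (hψi.mul_const c), integral_mul_const]
  have hae : ∀ᵐ x, x ∈ s → h x - c = 0 := hs.ae_eq_zero_of_integral_contDiff_smul_eq_zero
    ((hhc.sub continuousOn_const).locallyIntegrableOn hs.measurableSet)
    fun ψ hψ hψc hψs => horth ψ hψ.continuous hψc hψs
  refine ⟨c, Measure.eqOn_open_of_ae_eq (μ := volume) ?_ hs hhc continuousOn_const⟩
  rw [Filter.EventuallyEq, ae_restrict_iff' hs.measurableSet]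
  filter_upwards [hae] with x hx hxs using sub_eq_zero.1 (hx hxs)

lemma HasWeakDerivOn.hasDerivAt [s.OrdConnected] (hs : IsOpen s) (hhc : ContinuousOn h s)
    (hGc : ContinuousOn G s) (hh : HasWeakDerivOn h G s) {x : ℝ} (hx : x ∈ s) :
    HasDerivAt h (G x) x := by
  have hder : ∀ y ∈ s, HasDerivAt (fun y => ∫ t in x..y, G t) (G y) y := fun y hy =>
    intervalIntegral.integral_hasDerivAt_right
      (hGc.mono (‹s.OrdConnected›.uIcc_subset hx hy)).intervalIntegrable
      (hGc.stronglyMeasurableAtFilter hs y hy) (hGc.continuousAt (hs.mem_nhds hy))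
  have hPc : ContinuousOn (fun y => ∫ t in x..y, G t) s :=
    fun y hy => (hder y hy).continuousAt.continuousWithinAt
  have hsub := HasWeakDerivOn.sub hs hhc hGc hPc hGc hh (.of_hasDerivAt hs hder hGc)
  rw [sub_self] at hsub
  obtain ⟨c, hc⟩ := hsub.exists_eqOn_const hs (hhc.sub hPc)
  refine ((hder x hx).add_const c).congr_of_eventuallyEq ?_
  filter_upwards [hs.mem_nhds hx] with y hy using sub_eq_iff_eq_add'.1 (hc hy)

end WeakDerivative

section RealVariable

variable {f f' g : ℝ → ℝ} {a ℓ L : ℝ}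

lemma tendsto_zero_of_antitoneOn_of_forall_exists_lt (hg : AntitoneOn g (Ici a))
    (hg0 : ∀ r ∈ Ici a, 0 ≤ g r) (h : ∀ ε > 0, ∃ r ∈ Ici a, g r < ε) :
    Tendsto g atTop (𝓝 0) := by
  refine tendsto_order.2 ⟨fun ε hε => ?_, fun ε hε => ?_⟩
  · filter_upwards [eventually_ge_atTop a] with r hr using hε.trans_le (hg0 r hr)
  · obtain ⟨r, hr, hrε⟩ := h ε hε
    filter_upwards [eventually_ge_atTop r] with s hs
    exact (hg hr (hr.trans hs) hs).trans_lt hrε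

lemma exists_neg_div_lt_deriv (hf : ∀ r ∈ Ici 1, HasDerivAt f (f' r) r)
    (hf0 : ∀ r ∈ Ici 1, 0 ≤ f r) {δ : ℝ} (hδ : 0 < δ) : ∃ r ∈ Ici 1, -δ / r < f' r := by
  by_contra! hle
  have hder (r : ℝ) (hr : r ∈ Ici 1) :
      HasDerivAt (fun r => f r + δ * Real.log r) (f' r + δ * r⁻¹) r :=
    (hf r hr).add ((Real.hasDerivAt_log (one_pos.trans_le hr).ne').const_mul δ)
  have hanti : AntitoneOn (fun r => f r + δ * Real.log r) (Ici 1) := by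
    refine antitoneOn_of_hasDerivWithinAt_nonpos (f' := fun r => f' r + δ * r⁻¹) (convex_Ici 1)
      (fun r hr => (hder r hr).continuousAt.continuousWithinAt)
      (fun r hr => (hder r (interior_subset hr)).hasDerivWithinAt) fun r hr => ?_
    linarith [hle r (interior_subset hr), neg_div r δ, div_eq_mul_inv δ r]
  obtain ⟨r, hr, hfr⟩ := ((eventually_ge_atTop 1).and
    ((Real.tendsto_log_atTop.const_mul_atTop hδ).eventually_gt_atTop (f 1))).exists
  have hr1 := hanti self_mem_Ici hr hr
  simp only [Real.log_one, mul_zero, add_zero] at hr1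
  linarith [hf0 r hr]

lemma tendsto_zero_of_deriv_le_neg_div (hf : ∀ r ∈ Ici 1, HasDerivAt f (f' r) r)
    (hf0 : ∀ r ∈ Ici 1, 0 ≤ f r) (hg : AntitoneOn g (Ici 1)) (hg0 : ∀ r ∈ Ici 1, 0 ≤ g r)
    (hfg : ∀ ε > 0, ∃ δ > 0, ∀ r ∈ Ici 1, ε ≤ g r → f' r ≤ -δ / r) :
    Tendsto g atTop (𝓝 0) := by
  refine tendsto_zero_of_antitoneOn_of_forall_exists_lt hg hg0 fun ε hε => ?_
  obtain ⟨δ, hδ, h⟩ := hfg ε hε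
  obtain ⟨r, hr, hδr⟩ := exists_neg_div_lt_deriv hf hf0 hδ
  exact ⟨r, hr, lt_of_not_ge fun hge => (h r hr hge).not_gt hδr⟩

lemma integrableOn_and_integral_Ioi_of_hasDerivAt_neg (hf : ∀ x ∈ Ioi a, HasDerivAt f (-g x) x)
    (hg : ∀ x ∈ Ioi a, 0 ≤ g x) (ha : Tendsto f (𝓝[>] a) (𝓝 ℓ)) (hL : Tendsto f atTop (𝓝 L)) :
    IntegrableOn g (Ioi a) ∧ ∫ x in Ioi a, g x = ℓ - L := by
  have heq : EqOn (Function.update f a ℓ) f (Ioi a) :=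
    fun x hx => Function.update_of_ne (ne_of_gt hx) _ _
  have hcont : ContinuousWithinAt (Function.update f a ℓ) (Ici a) a := by
    rwa [continuousWithinAt_update_same, Ici_sdiff_left]
  have hder : ∀ x ∈ Ioi a, HasDerivAt (Function.update f a ℓ) (-g x) x := fun x hx =>
    (hf x hx).congr_of_eventuallyEq (heq.eventuallyEq_of_mem (Ioi_mem_nhds hx))
  have hlim : Tendsto (Function.update f a ℓ) atTop (𝓝 L) :=
    hL.congr' (heq.eventuallyEq_of_mem (Ioi_mem_atTop a)).symm
  have hneg : ∀ x ∈ Ioi a, -g x ≤ 0 := fun x hx => neg_nonpos.2 (hg x hx)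
  have hint := integral_Ioi_of_hasDerivAt_of_nonpos hcont hder hneg hlim
  rw [integral_neg, Function.update_self, neg_eq_iff_eq_neg, neg_sub] at hint
  exact ⟨by simpa using (integrableOn_Ioi_deriv_of_nonpos hcont hder hneg hlim).neg, hint⟩

end RealVariable

section Flux

variable {d : ℕ} {p q r : ℝ} {u : ℝ → ℝ}

/-- The size `r^{d-1} |u'|^{p-1}` of the flux weighted by `r^{d-1}`. -/
noncomputable def weightedFlux (d : ℕ) (p : ℝ) (u : ℝ → ℝ) (r : ℝ) : ℝ :=
  r ^ (d - 1) * |deriv u r| ^ (p - 1)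

lemma weightedFlux_nonneg (hr : 0 < r) : 0 ≤ weightedFlux d p u r := by
  unfold weightedFlux; positivity

lemma pFlux_eq_neg_of_deriv_nonpos (hp : 1 < p) (h : deriv u r ≤ 0) :
    pFlux p u r = -|deriv u r| ^ (p - 1) := by
  have hrpow := Real.rpow_add_one' (abs_nonneg (deriv u r)) (y := p - 2) (by linarith)
  rw [show p - 2 + 1 = p - 1 by ring] at hrpow
  rw [pFlux, hrpow, abs_of_nonpos h, mul_neg, neg_neg]

lemma pow_mul_pFlux_of_deriv_nonpos (hp : 1 < p) (h : deriv u r ≤ 0) :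
    r ^ (d - 1) * pFlux p u r = -weightedFlux d p u r := by
  rw [pFlux_eq_neg_of_deriv_nonpos hp h, mul_neg, weightedFlux]

lemma pow_pred_eq_rpow (hd : 1 ≤ d) (r : ℝ) : r ^ (d - 1) = r ^ ((d : ℝ) - 1) := by
  rw [← Real.rpow_natCast, Nat.cast_sub hd, Nat.cast_one]

lemma hasWeakDerivOn_neg_weightedFlux_iff (hp : 1 < p) (hu : ∀ r ∈ Ioi 0, deriv u r ≤ 0) :
    HasWeakDerivOn (fun r => -weightedFlux d p u r) (fun r => r ^ (d - 1) * u r ^ q) (Ioi 0) ↔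
      SolvesWeakly d p q u := by
  refine forall₄_congr fun φ _ _ _ => ?_
  rw [setIntegral_congr_fun measurableSet_Ioi fun r hr =>
    congrArg (deriv φ r * ·) (pow_mul_pFlux_of_deriv_nonpos (d := d) hp (hu r hr)).symm]

end Flux

namespace IsC1NonincreasingSolution

variable {d : ℕ} {p q r : ℝ} {u : ℝ → ℝ}

lemma nonneg (hu : IsC1NonincreasingSolution d p q u) (hr : 0 < r) : 0 ≤ u r :=
  le_of_tendsto hu.tendsto_atTop ((eventually_ge_atTop r).mono fun _ hs =>
    hu.antitoneOn hr (hr.trans_le hs) hs)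

lemma le_one (hu : IsC1NonincreasingSolution d p q u) (hr : 0 < r) : u r ≤ 1 := by
  refine ge_of_tendsto hu.tendsto_zero ?_
  filter_upwards [Ioc_mem_nhdsGT hr] with s hs using hu.antitoneOn hs.1 hr hs.2

lemma hasDerivAt (hu : IsC1NonincreasingSolution d p q u) (hr : 0 < r) :
    HasDerivAt u (deriv u r) r :=
  ((hu.contDiffOn.contDiffAt (Ioi_mem_nhds hr)).differentiableAt one_ne_zero).hasDerivAt

lemma deriv_nonpos (hu : IsC1NonincreasingSolution d p q u) (hr : 0 < r) : deriv u r ≤ 0 := by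
  rw [← derivWithin_of_isOpen isOpen_Ioi hr]
  exact hu.antitoneOn.derivWithin_nonpos

lemma continuousOn_weightedFlux (hu : IsC1NonincreasingSolution d p q u) (hp : 1 < p) :
    ContinuousOn (weightedFlux d p u) (Ioi 0) :=
  (continuous_pow _).continuousOn.mul ((hu.contDiffOn.continuousOn_deriv_of_isOpen isOpen_Ioi
    le_rfl).abs.rpow_const fun _ _ => Or.inr (by linarith))

lemma continuousOn_pow_mul_rpow (hu : IsC1NonincreasingSolution d p q u) {e : ℝ} (he : 0 ≤ e) :
    ContinuousOn (fun r : ℝ => r ^ (d - 1) * u r ^ e) (Ioi 0) :=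
  (continuous_pow _).continuousOn.mul
    (hu.contDiffOn.continuousOn.rpow_const fun _ _ => Or.inr he)

lemma pow_mul_rpow_nonneg (hu : IsC1NonincreasingSolution d p q u) (hr : 0 < r) (e : ℝ) :
    0 ≤ r ^ (d - 1) * u r ^ e :=
  mul_nonneg (pow_nonneg hr.le _) (Real.rpow_nonneg (hu.nonneg hr) _)

lemma hasDerivAt_weightedFlux (hu : IsC1NonincreasingSolution d p q u) (hp : 1 < p) (hq : 0 < q)
    (hr : 0 < r) : HasDerivAt (weightedFlux d p u) (-(r ^ (d - 1) * u r ^ q)) r := by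
  have hweak := (hasWeakDerivOn_neg_weightedFlux_iff hp fun _ => hu.deriv_nonpos).2 hu.equation
  simpa using (hweak.hasDerivAt isOpen_Ioi (hu.continuousOn_weightedFlux hp).neg
    (hu.continuousOn_pow_mul_rpow hq.le) hr).neg

lemma antitoneOn_weightedFlux (hu : IsC1NonincreasingSolution d p q u) (hp : 1 < p) (hq : 0 < q) :
    AntitoneOn (weightedFlux d p u) (Ioi 0) := by
  refine antitoneOn_of_hasDerivWithinAt_nonpos (f' := fun r => -(r ^ (d - 1) * u r ^ q))
    (convex_Ioi 0) (hu.continuousOn_weightedFlux hp) (fun r hr => ?_) fun r hr => ?_ <;>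
  rw [interior_Ioi] at hr
  · exact (hu.hasDerivAt_weightedFlux hp hq hr).hasDerivWithinAt
  · exact neg_nonpos.2 (hu.pow_mul_rpow_nonneg hr q)

lemma solvesPointwise (hu : IsC1NonincreasingSolution d p q u) (hd : 1 ≤ d) (hp : 1 < p)
    (hq : 0 < q) : SolvesPointwise d p q u := by
  intro r hr
  have hpFlux : (fun s => -(s ^ (1 - (d : ℝ)) * weightedFlux d p u s)) =ᶠ[𝓝 r] pFlux p u := by
    filter_upwards [lt_mem_nhds hr] with s hs
    rw [← neg_eq_iff_eq_neg.2 (pow_mul_pFlux_of_deriv_nonpos hp (hu.deriv_nonpos hs)),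
      pow_pred_eq_rpow hd, mul_neg, neg_neg, ← mul_assoc, ← Real.rpow_add hs, sub_add_sub_cancel,
      sub_self, Real.rpow_zero, one_mul]
  have hder := (((Real.hasDerivAt_rpow_const (p := 1 - (d : ℝ)) (Or.inl hr.ne')).mul
    (hu.hasDerivAt_weightedFlux hp hq hr)).neg).congr_of_eventuallyEq hpFlux.symm
  refine ⟨hder.differentiableAt, ?_⟩
  have hinv : r ^ (1 - (d : ℝ)) * r ^ (d - 1) = 1 := by
    rw [pow_pred_eq_rpow hd, ← Real.rpow_add hr]
    simp
  rw [hder.deriv, ← hpFlux.self_of_nhds, Real.rpow_sub_one hr.ne']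
  linear_combination u r ^ q * hinv

lemma deriv_neg (hu : IsC1NonincreasingSolution d p q u) (hp : 1 < p) (hq : 0 < q) (hr : 0 < r)
    (hur : 0 < u r) : deriv u r < 0 := by
  refine (hu.deriv_nonpos hr).lt_of_ne fun hzero => ?_
  have hderiv : ∀ s ≥ r, deriv u s = 0 := fun s hs => by
    have hs0 : 0 < s := hr.trans_le hs
    have hle := hu.antitoneOn_weightedFlux hp hq hr hs0 hs
    have hp0 : p - 1 ≠ 0 := by linarith
    have hflux := hle.antisymm (by
      simpa [weightedFlux, hzero, hp0] using weightedFlux_nonneg (d := d) (p := p) (u := u) hs0)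
    simpa [weightedFlux, hzero, hp0, hs0.ne', Real.rpow_eq_zero] using hflux
  have hconst : ∀ s ≥ r, u s = u r := fun s hs =>
    constant_of_has_deriv_right_zero
      (fun x hx => (hu.hasDerivAt (hr.trans_le hx.1)).continuousAt.continuousWithinAt)
      (fun x hx => hderiv x hx.1 ▸ (hu.hasDerivAt (hr.trans_le hx.1)).hasDerivWithinAt) s
      (right_mem_Icc.2 hs)
  exact hur.ne (tendsto_nhds_unique hu.tendsto_atTop
    (tendsto_const_nhds.congr' ((eventually_ge_atTop r).mono fun s hs => (hconst s hs).symm)))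

lemma exists_tendsto_weightedFlux_zero (hu : IsC1NonincreasingSolution d p q u) (hp : 1 < p)
    (hq : 0 < q) : ∃ ℓ, Tendsto (weightedFlux d p u) (𝓝[>] 0) (𝓝 ℓ) := by
  refine ⟨_, (hu.antitoneOn_weightedFlux hp hq).tendsto_nhdsGT
    ⟨weightedFlux d p u 1 + 1, forall_mem_image.2 fun r hr => ?_⟩⟩
  rcases le_total 1 r with h1r | hr1
  · linarith [hu.antitoneOn_weightedFlux hp hq (mem_Ioi.2 one_pos) hr h1r]
  have hbound : ∀ s ∈ Ioc (0 : ℝ) 1, ‖-(s ^ (d - 1) * u s ^ q)‖ ≤ 1 := fun s hs => by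
    rw [norm_neg, Real.norm_of_nonneg (hu.pow_mul_rpow_nonneg hs.1 q)]
    exact mul_le_one₀ (pow_le_one₀ hs.1.le hs.2) (Real.rpow_nonneg (hu.nonneg hs.1) _)
      (Real.rpow_le_one (hu.nonneg hs.1) (hu.le_one hs.1) hq.le)
  have hle := (convex_Ioc (0 : ℝ) 1).norm_image_sub_le_of_norm_hasDerivWithin_le
    (fun s hs => (hu.hasDerivAt_weightedFlux hp hq hs.1).hasDerivWithinAt) hbound
    (right_mem_Ioc.2 one_pos) (show r ∈ Ioc (0 : ℝ) 1 from ⟨hr, hr1⟩)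
  rw [Real.norm_eq_abs, Real.norm_of_nonpos (by linarith)] at hle
  linarith [le_abs_self (weightedFlux d p u r - weightedFlux d p u 1), mem_Ioi.1 hr]

lemma deriv_le_neg_div_of_le_weightedFlux (hu : IsC1NonincreasingSolution d p q u) (hd : 1 ≤ d)
    (hp : (d : ℝ) < p) {ε : ℝ} (hε : 0 < ε) (hr : 1 ≤ r) (hflux : ε ≤ weightedFlux d p u r) :
    deriv u r ≤ -ε ^ (p - 1)⁻¹ / r := by
  have hr0 : 0 < r := one_pos.trans_le hr
  have hp1 : 0 < p - 1 := by linarith [show (1 : ℝ) ≤ d by exact_mod_cast hd]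
  have hle : ε ≤ (r * |deriv u r|) ^ (p - 1) := by
    rw [Real.mul_rpow hr0.le (abs_nonneg _)]
    refine hflux.trans (mul_le_mul_of_nonneg_right ?_ (by positivity))
    rw [pow_pred_eq_rpow hd]
    exact Real.rpow_le_rpow_of_exponent_le hr (by linarith)
  rw [← Real.rpow_inv_le_iff_of_pos hε.le (by positivity) hp1,
    abs_of_nonpos (hu.deriv_nonpos hr0)] at hle
  rw [le_div_iff₀ hr0]
  linarith

lemma tendsto_weightedFlux_atTop (hu : IsC1NonincreasingSolution d p q u) (hd : 1 ≤ d)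
    (hp : (d : ℝ) < p) (hq : 0 < q) : Tendsto (weightedFlux d p u) atTop (𝓝 0) := by
  have hp1 : 1 < p := lt_of_le_of_lt (by exact_mod_cast hd) hp
  have hpos : Ici (1 : ℝ) ⊆ Ioi 0 := Ici_subset_Ioi.2 one_pos
  exact tendsto_zero_of_deriv_le_neg_div (fun r hr => hu.hasDerivAt (hpos hr))
    (fun r hr => hu.nonneg (hpos hr)) ((hu.antitoneOn_weightedFlux hp1 hq).mono hpos)
    (fun r hr => weightedFlux_nonneg (hpos hr)) fun ε hε => ⟨ε ^ (p - 1)⁻¹,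
      Real.rpow_pos_of_pos hε _, fun r hr => hu.deriv_le_neg_div_of_le_weightedFlux hd hp hε hr⟩

lemma hasDerivAt_mul_weightedFlux (hu : IsC1NonincreasingSolution d p q u) (hp : 1 < p)
    (hq : 0 < q) (hr : 0 < r) :
    HasDerivAt (fun s => u s * weightedFlux d p u s)
      (-(r ^ (d - 1) * |deriv u r| ^ p + r ^ (d - 1) * u r ^ (q + 1))) r := by
  refine ((hu.hasDerivAt hr).mul (hu.hasDerivAt_weightedFlux hp hq hr)).congr_deriv ?_
  have hrpow := Real.rpow_add_one' (abs_nonneg (deriv u r)) (y := p - 1) (by linarith)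
  rw [sub_add_cancel] at hrpow
  rw [hrpow, Real.rpow_add_one' (hu.nonneg hr) (by linarith), weightedFlux,
    abs_of_nonpos (hu.deriv_nonpos hr)]
  ring

lemma integrableOn_and_integral_rpow (hu : IsC1NonincreasingSolution d p q u) (hd : 1 ≤ d)
    (hp : (d : ℝ) < p) (hq : 0 < q) {ℓ : ℝ} (hℓ : Tendsto (weightedFlux d p u) (𝓝[>] 0) (𝓝 ℓ)) :
    IntegrableOn (fun r => r ^ (d - 1) * u r ^ q) (Ioi 0) ∧
      ∫ r in Ioi 0, r ^ (d - 1) * u r ^ q = ℓ := by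
  have hp1 : 1 < p := lt_of_le_of_lt (by exact_mod_cast hd) hp
  simpa using integrableOn_and_integral_Ioi_of_hasDerivAt_neg
    (fun r hr => hu.hasDerivAt_weightedFlux hp1 hq hr) (fun r hr => hu.pow_mul_rpow_nonneg hr q) hℓ
    (hu.tendsto_weightedFlux_atTop hd hp hq)

lemma integrableOn_and_integral_energy (hu : IsC1NonincreasingSolution d p q u) (hd : 1 ≤ d)
    (hp : (d : ℝ) < p) (hq : 0 < q) {ℓ : ℝ} (hℓ : Tendsto (weightedFlux d p u) (𝓝[>] 0) (𝓝 ℓ)) :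
    IntegrableOn (fun r => r ^ (d - 1) * |deriv u r| ^ p) (Ioi 0) ∧
      IntegrableOn (fun r => r ^ (d - 1) * u r ^ (q + 1)) (Ioi 0) ∧
      (∫ r in Ioi 0, r ^ (d - 1) * |deriv u r| ^ p)
        + ∫ r in Ioi 0, r ^ (d - 1) * u r ^ (q + 1) = ℓ := by
  have hp1 : 1 < p := lt_of_le_of_lt (by exact_mod_cast hd) hp
  have hgrad : ∀ r ∈ Ioi (0 : ℝ), 0 ≤ r ^ (d - 1) * |deriv u r| ^ p := fun r hr =>
    mul_nonneg (pow_nonneg (le_of_lt hr) _) (by positivity)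
  have hpot : ∀ r ∈ Ioi (0 : ℝ), 0 ≤ r ^ (d - 1) * u r ^ (q + 1) :=
    fun r hr => hu.pow_mul_rpow_nonneg hr _
  obtain ⟨hint, hval⟩ := integrableOn_and_integral_Ioi_of_hasDerivAt_neg
    (fun r hr => hu.hasDerivAt_mul_weightedFlux hp1 hq hr)
    (fun r hr => add_nonneg (hgrad r hr) (hpot r hr)) (hu.tendsto_zero.mul hℓ)
    (hu.tendsto_atTop.mul (hu.tendsto_weightedFlux_atTop hd hp hq))
  obtain ⟨hpot_int, hgrad_int⟩ := (integrable_add_iff_of_nonneg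
    ((hu.continuousOn_pow_mul_rpow (by linarith)).aestronglyMeasurable measurableSet_Ioi)
    (ae_restrict_of_forall_mem measurableSet_Ioi hpot)
    (ae_restrict_of_forall_mem measurableSet_Ioi hgrad)).1 (hint.congr_fun
      (fun r _ => add_comm _ _) measurableSet_Ioi)
  refine ⟨hgrad_int, hpot_int, ?_⟩
  rw [← integral_add hgrad_int hpot_int, hval, one_mul, mul_zero, sub_zero]

end IsC1NonincreasingSolution

section Descent

/-- A weight that is switched on at time `0`. Vanishing for negative times lets all integrals
`∫ s in 0..t` be handled on the whole line. -/
structure IsWeight (w : ℝ → ℝ) : Prop where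
  continuous : Continuous w
  eq_zero : ∀ t ≤ 0, w t = 0
  pos : ∀ t > 0, 0 < w t

/-- The solution with value `c` at time `0` of `x' = -w (z⁺)^e`. -/
noncomputable def descent (w : ℝ → ℝ) (e c : ℝ) (z : ℝ → ℝ) (t : ℝ) : ℝ :=
  c - ∫ s in 0..t, w s * (z s)⁺ ^ e

variable {w z z' : ℝ → ℝ} {e c c' B t : ℝ}

lemma IsWeight.nonneg (hw : IsWeight w) (t : ℝ) : 0 ≤ w t :=
  (le_or_gt t 0).elim (fun ht => (hw.eq_zero t ht).ge) fun ht => (hw.pos t ht).le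

lemma descent_zero : descent w e c z 0 = c := by simp [descent]

lemma descent_of_nonpos (hw : IsWeight w) (ht : t ≤ 0) : descent w e c z t = c := by
  have hzero : ∫ s in 0..t, w s * (z s)⁺ ^ e = 0 :=
    intervalIntegral.integral_zero_ae (ae_of_all _ fun s hs => by
      rw [hw.eq_zero s ((uIoc_of_ge ht ▸ hs).2), zero_mul])
  rw [descent, hzero, sub_zero]

lemma norm_mul_posPart_rpow_le (hw : IsWeight w) (he : 0 ≤ e) {x : ℝ} (hx : x ≤ B) (s : ℝ) :
    ‖w s * x⁺ ^ e‖ ≤ w s * B⁺ ^ e := by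
  rw [Real.norm_of_nonneg (mul_nonneg (hw.nonneg s) (Real.rpow_nonneg (posPart_nonneg x) e))]
  exact mul_le_mul_of_nonneg_left
    (Real.rpow_le_rpow (posPart_nonneg x) (posPart_mono hx) he) (hw.nonneg s)

lemma measurable_mul_posPart_rpow (hw : IsWeight w) (hz : Measurable z) :
    Measurable fun s => w s * (z s)⁺ ^ e :=
  hw.continuous.measurable.mul ((continuous_posPart.measurable.comp hz).pow_const e)

lemma continuous_mul_posPart_rpow (hw : IsWeight w) (he : 0 ≤ e) (hz : Continuous z) :
    Continuous fun s => w s * (z s)⁺ ^ e :=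
  hw.continuous.mul ((continuous_posPart.comp hz).rpow_const fun _ => Or.inr he)

lemma intervalIntegrable_mul_posPart_rpow (hw : IsWeight w) (he : 0 ≤ e) (hz : Measurable z)
    (hzB : ∀ s, z s ≤ B) (a b : ℝ) :
    IntervalIntegrable (fun s => w s * (z s)⁺ ^ e) volume a b :=
  ((hw.continuous.mul continuous_const).intervalIntegrable a b).mono_fun'
    (measurable_mul_posPart_rpow hw hz).aestronglyMeasurable
    (ae_of_all _ fun s => norm_mul_posPart_rpow_le hw he (hzB s) s)

lemma continuous_descent_of_le (hw : IsWeight w) (he : 0 ≤ e) (hz : Measurable z)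
    (hzB : ∀ s, z s ≤ B) : Continuous (descent w e c z) :=
  continuous_const.sub (intervalIntegral.continuous_primitive
    (intervalIntegrable_mul_posPart_rpow hw he hz hzB) 0)

lemma hasDerivAt_descent (hw : IsWeight w) (he : 0 ≤ e) (hz : Continuous z) (t : ℝ) :
    HasDerivAt (descent w e c z) (-(w t * (z t)⁺ ^ e)) t :=
  ((continuous_mul_posPart_rpow hw he hz).integral_hasStrictDerivAt 0 t).hasDerivAt.const_sub c

lemma continuous_descent (hw : IsWeight w) (he : 0 ≤ e) (hz : Continuous z) :
    Continuous (descent w e c z) :=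
  continuous_iff_continuousAt.2 fun t => (hasDerivAt_descent hw he hz t).continuousAt

lemma descent_le (hw : IsWeight w) (t : ℝ) : descent w e c z t ≤ c := by
  rcases le_total t 0 with ht | ht
  · exact (descent_of_nonpos hw ht).le
  · exact sub_le_self c (intervalIntegral.integral_nonneg ht fun s _ =>
      mul_nonneg (hw.nonneg s) (Real.rpow_nonneg (posPart_nonneg _) e))

lemma descent_le_descent (hw : IsWeight w) (he : 0 ≤ e) (hz : Continuous z) (hz' : Continuous z')
    (hzz' : ∀ s ∈ Icc 0 t, z s ≤ z' s) (hc : c' ≤ c) : descent w e c' z' t ≤ descent w e c z t := by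
  rcases le_total t 0 with ht | ht
  · rwa [descent_of_nonpos hw ht, descent_of_nonpos hw ht]
  · exact sub_le_sub hc (intervalIntegral.integral_mono_on ht
      ((continuous_mul_posPart_rpow hw he hz).intervalIntegrable _ _)
      ((continuous_mul_posPart_rpow hw he hz').intervalIntegrable _ _) fun s hs =>
        mul_le_mul_of_nonneg_left
          (Real.rpow_le_rpow (posPart_nonneg _) (posPart_mono (hzz' s hs)) he) (hw.nonneg s))

lemma tendsto_descent {ι : Type*} {l : Filter ι} [l.IsCountablyGenerated] {c : ι → ℝ} {c₀ : ℝ}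
    {z : ι → ℝ → ℝ} {ζ : ℝ → ℝ} (hw : IsWeight w) (he : 0 ≤ e) (hz : ∀ i, Continuous (z i))
    (hzB : ∀ᶠ i in l, ∀ s, z i s ≤ B) (hc : Tendsto c l (𝓝 c₀))
    (hζ : ∀ s, Tendsto (z · s) l (𝓝 (ζ s))) (t : ℝ) :
    Tendsto (fun i => descent w e (c i) (z i) t) l (𝓝 (descent w e c₀ ζ t)) :=
  hc.sub (intervalIntegral.tendsto_integral_filter_of_dominated_convergence
    (fun s => w s * B⁺ ^ e)
    (Eventually.of_forall fun i => (continuous_mul_posPart_rpow hw he (hz i)).aestronglyMeasurable)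
    (hzB.mono fun _ hi => ae_of_all _ fun s _ => norm_mul_posPart_rpow_le hw he (hi s) s)
    ((hw.continuous.mul continuous_const).intervalIntegrable 0 t)
    (ae_of_all _ fun s _ => tendsto_const_nhds.mul
      ((continuous_posPart.continuousAt.tendsto.comp (hζ s)).rpow_const (Or.inr he))))

end Descent

section EmdenFowler

/-- The pair `(x, y)` solves the Emden–Fowler system `x' = -a y^α`, `y' = -b x^β` with value
`(x₀, y₀)` at time `0`. Negative values count as `0` in the powers, so that solutions continue past
their zeros: a component stays constant from the time on at which the other one vanishes. -/
structure IsEmdenFowler (a b : ℝ → ℝ) (α β x₀ y₀ : ℝ) (x y : ℝ → ℝ) : Prop where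
  hasDerivAt_fst : ∀ t, HasDerivAt x (-(a t * (y t)⁺ ^ α)) t
  hasDerivAt_snd : ∀ t, HasDerivAt y (-(b t * (x t)⁺ ^ β)) t
  fst_zero : x 0 = x₀
  snd_zero : y 0 = y₀

variable {a b x y x' y' : ℝ → ℝ} {α β x₀ y₀ : ℝ}

lemma isEmdenFowler_descent (ha : IsWeight a) (hb : IsWeight b) (hα : 0 ≤ α) (hβ : 0 ≤ β)
    (hx : Continuous x) (hfix : descent a α x₀ (descent b β y₀ x) = x) :
    IsEmdenFowler a b α β x₀ y₀ x (descent b β y₀ x) := by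
  refine ⟨fun t => ?_, hasDerivAt_descent hb hβ hx, ?_, descent_zero⟩
  · have hxt := hasDerivAt_descent (c := x₀) ha hα (continuous_descent (c := y₀) hb hβ hx) t
    rwa [hfix] at hxt
  · rw [← hfix, descent_zero]

lemma isEmdenFowler_of_tendsto {ι : Type*} {l : Filter ι} [l.NeBot] [l.IsCountablyGenerated]
    {c : ι → ℝ} {z : ι → ℝ → ℝ} {ξ : ℝ → ℝ} {B : ℝ} (ha : IsWeight a) (hb : IsWeight b)
    (hα : 0 ≤ α) (hβ : 0 ≤ β) (hz : ∀ i, Continuous (z i)) (hzB : ∀ i s, z i s ≤ B)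
    (hc : Tendsto c l (𝓝 y₀)) (hξ : ∀ t, Tendsto (z · t) l (𝓝 (ξ t)))
    (hdescent : ∀ t, Tendsto (fun i => descent a α x₀ (descent b β (c i) (z i)) t) l (𝓝 (ξ t))) :
    IsEmdenFowler a b α β x₀ y₀ ξ (descent b β y₀ ξ) := by
  have hξ_measurable : Measurable ξ :=
    measurable_of_tendsto_metrizable' l (fun i => (hz i).measurable) (tendsto_pi_nhds.2 hξ)
  have hξB : ∀ s, ξ s ≤ B := fun s => le_of_tendsto (hξ s) (Eventually.of_forall fun i => hzB i s)
  have hy_cont : Continuous (descent b β y₀ ξ) := continuous_descent_of_le hb hβ hξ_measurable hξB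
  have hzy_cont : ∀ i, Continuous (descent b β (c i) (z i)) := fun i =>
    continuous_descent_of_le hb hβ (hz i).measurable (hzB i)
  have hzy_le : ∀ᶠ i in l, ∀ s, descent b β (c i) (z i) s ≤ y₀ + 1 :=
    (hc.eventually_le_const (lt_add_one y₀)).mono fun _ hi s => (descent_le hb s).trans hi
  have hfix : descent a α x₀ (descent b β y₀ ξ) = ξ := funext fun t =>
    tendsto_nhds_unique (tendsto_descent ha hα hzy_cont hzy_le tendsto_const_nhds
      (tendsto_descent hb hβ hz (Eventually.of_forall hzB) hc hξ) t) (hdescent t)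
  refine isEmdenFowler_descent ha hb hα hβ ?_ hfix
  exact hfix ▸ continuous_descent_of_le ha hα hy_cont.measurable fun s => descent_le hb s

namespace IsEmdenFowler

lemma symm (h : IsEmdenFowler a b α β x₀ y₀ x y) : IsEmdenFowler b a β α y₀ x₀ y x :=
  ⟨h.hasDerivAt_snd, h.hasDerivAt_fst, h.snd_zero, h.fst_zero⟩

lemma continuous_fst (h : IsEmdenFowler a b α β x₀ y₀ x y) : Continuous x :=
  continuous_iff_continuousAt.2 fun t => (h.hasDerivAt_fst t).continuousAt

lemma continuous_snd (h : IsEmdenFowler a b α β x₀ y₀ x y) : Continuous y :=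
  h.symm.continuous_fst

lemma antitone_fst (h : IsEmdenFowler a b α β x₀ y₀ x y) (ha : IsWeight a) : Antitone x :=
  antitone_of_hasDerivAt_nonpos h.hasDerivAt_fst fun t =>
    neg_nonpos.2 (mul_nonneg (ha.nonneg t) (Real.rpow_nonneg (posPart_nonneg _) α))

lemma fst_eq_descent (h : IsEmdenFowler a b α β x₀ y₀ x y) (ha : IsWeight a) (hα : 0 ≤ α) :
    x = descent a α x₀ y := by
  funext t
  have hint := intervalIntegral.integral_eq_sub_of_hasDerivAt (fun s _ => h.hasDerivAt_fst s)
    ((continuous_mul_posPart_rpow ha hα h.continuous_snd).neg.intervalIntegrable 0 t)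
  rw [intervalIntegral.integral_neg, h.fst_zero] at hint
  rw [descent]
  linarith

lemma snd_eq_descent (h : IsEmdenFowler a b α β x₀ y₀ x y) (hb : IsWeight b) (hβ : 0 ≤ β) :
    y = descent b β y₀ x :=
  h.symm.fst_eq_descent hb hβ

lemma fst_le (h : IsEmdenFowler a b α β x₀ y₀ x y) (ha : IsWeight a) (hα : 0 ≤ α) (t : ℝ) :
    x t ≤ x₀ := by
  rw [h.fst_eq_descent ha hα]
  exact descent_le ha t

lemma fst_of_nonpos (h : IsEmdenFowler a b α β x₀ y₀ x y) (ha : IsWeight a) (hα : 0 ≤ α) {t : ℝ}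
    (ht : t ≤ 0) : x t = x₀ := by
  rw [h.fst_eq_descent ha hα, descent_of_nonpos ha ht]

lemma fst_eq_of_snd_nonpos (h : IsEmdenFowler a b α β x₀ y₀ x y) (hb : IsWeight b) (hα : 0 < α)
    {R t : ℝ} (hR : y R ≤ 0) (hRt : R ≤ t) : x t = x R := by
  refine constant_of_has_deriv_right_zero h.continuous_fst.continuousOn (fun s hs => ?_) t
    (right_mem_Icc.2 hRt)
  have hys : y s ≤ 0 := (h.symm.antitone_fst hb hs.1).trans hR
  have hder := h.hasDerivAt_fst s
  rw [posPart_eq_zero.2 hys, Real.zero_rpow hα.ne', mul_zero, neg_zero] at hder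
  exact hder.hasDerivWithinAt

lemma snd_pos_of_fst_neg (h : IsEmdenFowler a b α β x₀ y₀ x y) (ha : IsWeight a)
    (hb : IsWeight b) (hα : 0 < α) (hβ : 0 < β) (hx₀ : 0 ≤ x₀) {S : ℝ} (hS : x S < 0) (t : ℝ) :
    0 < y t := by
  obtain ⟨s, hsS, hs⟩ : ∃ s ≤ S, x s = 0 := by
    have hS0 : 0 ≤ S := (h.antitone_fst ha).reflect_lt (by rw [h.fst_zero]; linarith) |>.le
    obtain ⟨s, hs, hxs⟩ := intermediate_value_Icc' hS0 h.continuous_fst.continuousOn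
      ⟨hS.le, h.fst_zero ▸ hx₀⟩
    exact ⟨s, hs.2, hxs⟩
  have hys : 0 < y s := by
    by_contra! hys
    exact hS.ne (hs ▸ h.fst_eq_of_snd_nonpos hb hα hys hsS)
  rcases le_total t s with hts | hst
  · exact hys.trans_le (h.symm.antitone_fst hb hts)
  · rwa [h.symm.fst_eq_of_snd_nonpos ha hβ hs.le hst]

end IsEmdenFowler

lemma exists_lipschitzOnWith_mul_posPart_rpow {w : ℝ → ℝ} {c : ℝ} (hw : IsWeight w) (hc : 0 < c)
    (e B T : ℝ) :
    ∃ K, ∀ t ∈ Icc 0 T, LipschitzOnWith K (fun s : ℝ => -(w t * s⁺ ^ e)) (Icc c B) := by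
  have hsmooth : ContDiffOn ℝ 1 (fun s : ℝ => s⁺ ^ e) (Icc c B) :=
    ContDiffOn.congr
      (fun s hs => (Real.contDiffAt_rpow_const_of_ne (hc.trans_le hs.1).ne').contDiffWithinAt)
      fun s hs => by rw [posPart_of_nonneg (hc.le.trans hs.1)]
  obtain ⟨K, hK⟩ := hsmooth.exists_lipschitzOnWith one_ne_zero (convex_Icc c B) isCompact_Icc
  obtain ⟨M, hM⟩ := isCompact_Icc.exists_bound_of_continuousOn (s := Icc 0 T)
    hw.continuous.continuousOn
  refine ⟨M.toNNReal * K, fun t ht => LipschitzOnWith.of_dist_le_mul fun s hs s' hs' => ?_⟩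
  calc dist (-(w t * s⁺ ^ e)) (-(w t * s'⁺ ^ e)) = ‖w t‖ * dist (s⁺ ^ e) (s'⁺ ^ e) := by
        rw [dist_neg_neg, Real.dist_eq, Real.dist_eq, ← mul_sub, abs_mul, Real.norm_eq_abs]
    _ ≤ M.toNNReal * (K * dist s s') :=
        mul_le_mul ((hM t ht).trans (Real.le_coe_toNNReal M)) (hK.dist_le_mul s hs s' hs')
          dist_nonneg M.toNNReal.coe_nonneg
    _ = (M.toNNReal * K : NNReal) * dist s s' := by push_cast; ring

namespace IsEmdenFowler

lemma eqOn_Icc_of_pos (h : IsEmdenFowler a b α β x₀ y₀ x y)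
    (h' : IsEmdenFowler a b α β x₀ y₀ x' y') (ha : IsWeight a) (hb : IsWeight b) (hα : 0 ≤ α)
    (hβ : 0 ≤ β) {T : ℝ} (hT : 0 < min (min (x T) (y T)) (min (x' T) (y' T))) :
    EqOn (fun t => (x t, y t)) (fun t => (x' t, y' t)) (Icc 0 T) := by
  set c := min (min (x T) (y T)) (min (x' T) (y' T))
  obtain ⟨Ka, hKa⟩ := exists_lipschitzOnWith_mul_posPart_rpow ha hT α (max x₀ y₀) T
  obtain ⟨Kb, hKb⟩ := exists_lipschitzOnWith_mul_posPart_rpow hb hT β (max x₀ y₀) T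
  have hmem : ∀ {z w : ℝ → ℝ}, IsEmdenFowler a b α β x₀ y₀ z w → c ≤ min (z T) (w T) →
      ∀ t ∈ Ico 0 T, (z t, w t) ∈ Icc c (max x₀ y₀) ×ˢ Icc c (max x₀ y₀) := fun hzw hcT t ht =>
    ⟨⟨(le_min_iff.1 hcT).1.trans (hzw.antitone_fst ha ht.2.le),
        (hzw.fst_le ha hα t).trans (le_max_left _ _)⟩,
      ⟨(le_min_iff.1 hcT).2.trans (hzw.symm.antitone_fst hb ht.2.le),
        (hzw.symm.fst_le hb hβ t).trans (le_max_right _ _)⟩⟩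
  refine ODE_solution_unique_of_mem_Icc_right
    (v := fun t p => (-(a t * p.2⁺ ^ α), -(b t * p.1⁺ ^ β)))
    (s := fun _ => Icc c (max x₀ y₀) ×ˢ Icc c (max x₀ y₀)) (K := max (Ka * 1) (Kb * 1))
    (fun t ht => ?_) (h.continuous_fst.prodMk h.continuous_snd).continuousOn
    (fun t _ => ((h.hasDerivAt_fst t).prodMk (h.hasDerivAt_snd t)).hasDerivWithinAt)
    (hmem h (min_le_left _ _)) (h'.continuous_fst.prodMk h'.continuous_snd).continuousOn
    (fun t _ => ((h'.hasDerivAt_fst t).prodMk (h'.hasDerivAt_snd t)).hasDerivWithinAt)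
    (hmem h' (min_le_right _ _)) ?_
  · have ht' : t ∈ Icc 0 T := Ico_subset_Icc_self ht
    exact ((hKa t ht').comp LipschitzWith.prod_snd.lipschitzOnWith fun p hp => hp.2).prodMk
      ((hKb t ht').comp LipschitzWith.prod_fst.lipschitzOnWith fun p hp => hp.1)
  · simp only [h.fst_zero, h.snd_zero, h'.fst_zero, h'.snd_zero]

lemma eq_of_eqOn_Icc_of_snd_nonpos (h : IsEmdenFowler a b α β x₀ y₀ x y)
    (h' : IsEmdenFowler a b α β x₀ y₀ x' y') (ha : IsWeight a) (hb : IsWeight b) (hα : 0 < α)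
    (hβ : 0 ≤ β) {s : ℝ} (hs : 0 ≤ s)
    (heq : EqOn (fun t => (x t, y t)) (fun t => (x' t, y' t)) (Icc 0 s)) (hys : y s ≤ 0) :
    x = x' ∧ y = y' := by
  obtain ⟨hxs, hys'⟩ : x s = x' s ∧ y s = y' s := Prod.ext_iff.1 (heq (right_mem_Icc.2 hs))
  have hx : x = x' := by
    funext t
    rcases le_total t 0 with ht | ht
    · rw [h.fst_of_nonpos ha hα.le ht, h'.fst_of_nonpos ha hα.le ht]
    rcases le_total t s with hts | hst
    · exact congrArg Prod.fst (heq ⟨ht, hts⟩)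
    · exact (h.fst_eq_of_snd_nonpos hb hα hys hst).trans
        (hxs.trans (h'.fst_eq_of_snd_nonpos hb hα (hys' ▸ hys) hst).symm)
  exact ⟨hx, by rw [h.snd_eq_descent hb hβ, h'.snd_eq_descent hb hβ, hx]⟩

lemma eqOn_Icc_of_pos_Ico (h : IsEmdenFowler a b α β x₀ y₀ x y)
    (h' : IsEmdenFowler a b α β x₀ y₀ x' y') (ha : IsWeight a) (hb : IsWeight b) (hα : 0 ≤ α)
    (hβ : 0 ≤ β) {s : ℝ}
    (hpos : ∀ t ∈ Ico 0 s, 0 < min (min (x t) (y t)) (min (x' t) (y' t))) :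
    EqOn (fun t => (x t, y t)) (fun t => (x' t, y' t)) (Icc 0 s) := by
  rcases eq_or_ne 0 s with rfl | hs
  · intro t ht
    obtain rfl : t = 0 := le_antisymm ht.2 ht.1
    simp only [h.fst_zero, h.snd_zero, h'.fst_zero, h'.snd_zero]
  · rw [← closure_Ico hs]
    refine EqOn.closure (fun t ht => ?_) (h.continuous_fst.prodMk h.continuous_snd)
      (h'.continuous_fst.prodMk h'.continuous_snd)
    exact h.eqOn_Icc_of_pos h' ha hb hα hβ (hpos t ht) (right_mem_Icc.2 ht.1)

theorem unique (h : IsEmdenFowler a b α β x₀ y₀ x y) (h' : IsEmdenFowler a b α β x₀ y₀ x' y')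
    (ha : IsWeight a) (hb : IsWeight b) (hα : 0 < α) (hβ : 0 < β) : x = x' ∧ y = y' := by
  set P : ℝ → ℝ := fun t => min (min (x t) (y t)) (min (x' t) (y' t)) with hP
  have hP_cont : Continuous P :=
    (h.continuous_fst.min h.continuous_snd).min (h'.continuous_fst.min h'.continuous_snd)
  by_cases hpos : ∀ t ≥ 0, 0 < P t
  · have hpair : ∀ t, (x t, y t) = (x' t, y' t) := fun t => by
      rcases le_total t 0 with ht | ht
      · rw [h.fst_of_nonpos ha hα.le ht, h'.fst_of_nonpos ha hα.le ht,
          h.symm.fst_of_nonpos hb hβ.le ht, h'.symm.fst_of_nonpos hb hβ.le ht]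
      · exact h.eqOn_Icc_of_pos h' ha hb hα.le hβ.le (hpos t ht) (right_mem_Icc.2 ht)
    exact ⟨funext fun t => congrArg Prod.fst (hpair t), funext fun t => congrArg Prod.snd (hpair t)⟩
  · push Not at hpos
    -- The solutions agree up to the first time `s` at which one of the components vanishes.
    obtain ⟨s, ⟨hs, hPs⟩, hfirst⟩ : ∃ s, IsLeast {t | 0 ≤ t ∧ P t ≤ 0} s :=
      ⟨_, (isClosed_Ici.inter (isClosed_le hP_cont continuous_const)).isLeast_csInf hpos
        ⟨0, fun _ ht => ht.1⟩⟩
    have heqs := h.eqOn_Icc_of_pos_Ico h' ha hb hα.le hβ.le fun t ht =>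
      not_le.1 fun hPt => ht.2.not_ge (hfirst ⟨ht.1, hPt⟩)
    obtain ⟨hxs, hys⟩ : x s = x' s ∧ y s = y' s := Prod.ext_iff.1 (heqs (right_mem_Icc.2 hs))
    have hdead : x s ≤ 0 ∨ y s ≤ 0 := by
      simpa only [hP, min_le_iff, ← hxs, ← hys, or_self] using hPs
    rcases hdead with hxs | hys
    · exact (h.symm.eq_of_eqOn_Icc_of_snd_nonpos h'.symm hb ha hβ hα.le hs
        (fun t ht => congrArg Prod.swap (heqs ht)) hxs).symm
    · exact h.eq_of_eqOn_Icc_of_snd_nonpos h' ha hb hα hβ.le hs heqs hys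

end IsEmdenFowler

/-- The Picard iteration for the first component of the Emden–Fowler system with initial value
`(x₀, m)`. Both of its integrations reverse the order, so it is monotone. -/
noncomputable def picardMap (ha : IsWeight a) (hb : IsWeight b) (hα : 0 ≤ α) (hβ : 0 ≤ β)
    (x₀ m : ℝ) (z : C(ℝ, ℝ)) : C(ℝ, ℝ) where
  toFun := descent a α x₀ (descent b β m z)
  continuous_toFun := continuous_descent ha hα (continuous_descent hb hβ z.continuous)

section PicardMap

variable {ha : IsWeight a} {hb : IsWeight b} {hα : 0 ≤ α} {hβ : 0 ≤ β} {m m' : ℝ}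

lemma picardMap_le_picardMap {z z' : C(ℝ, ℝ)} (hm : m ≤ m') (hz : z ≤ z') :
    picardMap ha hb hα hβ x₀ m' z ≤ picardMap ha hb hα hβ x₀ m z' := fun _ =>
  descent_le_descent ha hα (continuous_descent hb hβ z'.continuous)
    (continuous_descent hb hβ z.continuous)
    (fun _ _ => descent_le_descent hb hβ z.continuous z'.continuous (fun _ _ => hz _) hm) le_rfl

lemma picardMap_monotone : Monotone (picardMap ha hb hα hβ x₀ m) := fun _ _ =>
  picardMap_le_picardMap le_rfl

lemma picardMap_le (z : C(ℝ, ℝ)) :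
    picardMap ha hb hα hβ x₀ m z ≤ ContinuousMap.const ℝ x₀ := fun _ => descent_le ha _

lemma antitone_picardMap_iterate :
    Antitone fun n => (picardMap ha hb hα hβ x₀ m)^[n] (ContinuousMap.const ℝ x₀) :=
  picardMap_monotone.antitone_iterate_of_map_le (picardMap_le _)

lemma bddBelow_picardMap_iterate (t : ℝ) : BddBelow (range fun n =>
    (picardMap ha hb hα hβ x₀ m)^[n] (ContinuousMap.const ℝ x₀) t) := by
  refine ⟨descent a α x₀ (fun _ => m) t, forall_mem_range.2 fun n => ?_⟩
  refine le_trans ?_ (antitone_picardMap_iterate n.le_succ t)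
  simp only [Function.iterate_succ_apply']
  exact descent_le_descent ha hα (continuous_descent hb hβ (ContinuousMap.continuous _))
    continuous_const (fun s _ => descent_le hb s) le_rfl

lemma picardMap_iterate_le_of_le (hm : m ≤ m') (n : ℕ) :
    (picardMap ha hb hα hβ x₀ m')^[n] (ContinuousMap.const ℝ x₀) ≤
      (picardMap ha hb hα hβ x₀ m)^[n] (ContinuousMap.const ℝ x₀) :=
  picardMap_monotone.iterate_le_of_le (fun _ => picardMap_le_picardMap hm le_rfl) n _

end PicardMap

theorem exists_isEmdenFowler (ha : IsWeight a) (hb : IsWeight b) (hα : 0 ≤ α) (hβ : 0 ≤ β)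
    (x₀ : ℝ) : ∃ x y : ℝ → ℝ → ℝ, (∀ m, IsEmdenFowler a b α β x₀ m (x m) (y m)) ∧
      ∀ t, Antitone fun m => x m t := by
  set z : ℝ → ℕ → C(ℝ, ℝ) := fun m n =>
    (picardMap ha hb hα hβ x₀ m)^[n] (ContinuousMap.const ℝ x₀) with hz
  have hlim : ∀ m t, Tendsto (fun n => z m n t) atTop (𝓝 (⨅ n, z m n t)) := fun m t =>
    tendsto_atTop_ciInf (fun _ _ hn => antitone_picardMap_iterate hn t)
      (bddBelow_picardMap_iterate t)
  refine ⟨fun m t => ⨅ n, z m n t, fun m => descent b β m fun t => ⨅ n, z m n t, fun m => ?_,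
    fun t m m' hm => ciInf_mono (bddBelow_picardMap_iterate t) fun n =>
      picardMap_iterate_le_of_le hm n t⟩
  refine isEmdenFowler_of_tendsto (z := fun n => z m n) (B := x₀) ha hb hα hβ
    (fun n => (z m n).continuous) (fun n s => antitone_picardMap_iterate n.zero_le s)
    tendsto_const_nhds (hlim m) fun t => ?_
  refine ((hlim m t).comp (tendsto_add_atTop_nat 1)).congr fun n => ?_
  simp only [hz, Function.comp_apply, Function.iterate_succ_apply']
  rfl

section Shooting

variable {X Y : ℝ → ℝ → ℝ}

lemma tendsto_fst_of_exists_tendsto {l : Filter ℝ} [l.NeBot] [l.IsCountablyGenerated] {m₀ : ℝ}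
    (ha : IsWeight a) (hb : IsWeight b) (hα : 0 < α) (hβ : 0 < β)
    (hXY : ∀ m, IsEmdenFowler a b α β x₀ m (X m) (Y m)) (hl : l ≤ 𝓝 m₀)
    (hlim : ∀ t, ∃ L, Tendsto (fun m => X m t) l (𝓝 L)) (t : ℝ) :
    Tendsto (fun m => X m t) l (𝓝 (X m₀ t)) := by
  choose ξ hξ using hlim
  have hξ_sol : IsEmdenFowler a b α β x₀ m₀ ξ (descent b β m₀ ξ) := by
    refine isEmdenFowler_of_tendsto ha hb hα.le hβ.le (fun m => (hXY m).continuous_fst)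
      (fun m => (hXY m).fst_le ha hα.le) hl hξ fun t => (hξ t).congr fun m => ?_
    rw [← (hXY m).snd_eq_descent hb hβ.le, ← (hXY m).fst_eq_descent ha hα.le]
  rw [← (hξ_sol.unique (hXY m₀) ha hb hα hβ).1]
  exact hξ t

lemma continuous_fst_of_antitone (ha : IsWeight a) (hb : IsWeight b) (hα : 0 < α) (hβ : 0 < β)
    (hXY : ∀ m, IsEmdenFowler a b α β x₀ m (X m) (Y m)) (hX : ∀ t, Antitone fun m => X m t)
    (t : ℝ) : Continuous fun m => X m t :=
  continuous_iff_continuousAt.2 fun m₀ => continuousAt_iff_continuous_left'_right'.2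
    ⟨tendsto_fst_of_exists_tendsto ha hb hα hβ hXY nhdsWithin_le_nhds
        (fun s => ⟨_, (hX s).tendsto_nhdsLT m₀⟩) t,
      tendsto_fst_of_exists_tendsto ha hb hα hβ hXY nhdsWithin_le_nhds
        (fun s => ⟨_, (hX s).tendsto_nhdsGT m₀⟩) t⟩

lemma continuous_snd_of_continuous_fst (ha : IsWeight a) (hb : IsWeight b) (hα : 0 ≤ α)
    (hβ : 0 ≤ β) (hXY : ∀ m, IsEmdenFowler a b α β x₀ m (X m) (Y m))
    (hX : ∀ t, Continuous fun m => X m t) (t : ℝ) : Continuous fun m => Y m t := by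
  simp only [fun m => (hXY m).snd_eq_descent hb hβ]
  exact continuous_iff_continuousAt.2 fun m₀ => tendsto_descent hb hβ
    (fun m => (hXY m).continuous_fst) (Eventually.of_forall fun m => (hXY m).fst_le ha hα)
    tendsto_id (fun s => (hX s).continuousAt) t

lemma exists_fst_neg (ha : IsWeight a) (hb : IsWeight b) (hα : 0 < α) (hβ : 0 ≤ β)
    (hXY : ∀ m, IsEmdenFowler a b α β x₀ m (X m) (Y m)) : ∃ m, X m 1 < 0 := by
  set A := ∫ s in 0..1, a s
  have hA_pos : 0 < A := intervalIntegral.intervalIntegral_pos_of_pos_on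
    (ha.continuous.intervalIntegrable 0 1) (fun s hs => ha.pos s hs.1) one_pos
  obtain ⟨M, hM, hM0⟩ : ∃ M : ℝ, x₀ < M ^ α * A ∧ 0 ≤ M :=
    (((tendsto_rpow_atTop hα).atTop_mul_const hA_pos).eventually_gt_atTop x₀ |>.and
      (eventually_ge_atTop 0)).exists
  set C := ∫ s in 0..1, b s * x₀⁺ ^ β
  have hY : ∀ s ∈ Icc (0 : ℝ) 1, M ≤ Y (M + C) s := fun s hs =>
    calc M = descent b β (M + C) (fun _ => x₀) 1 := (add_sub_cancel_right M C).symm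
      _ ≤ descent b β (M + C) (X (M + C)) 1 := descent_le_descent hb hβ
          (hXY _).continuous_fst continuous_const (fun s _ => (hXY _).fst_le ha hα.le s) le_rfl
      _ = Y (M + C) 1 := by rw [← (hXY _).snd_eq_descent hb hβ]
      _ ≤ Y (M + C) s := (hXY _).symm.antitone_fst hb hs.2
  refine ⟨M + C, ?_⟩
  calc X (M + C) 1 = descent a α x₀ (Y (M + C)) 1 := by rw [← (hXY _).fst_eq_descent ha hα.le]
    _ ≤ descent a α x₀ (fun _ => M) 1 := descent_le_descent ha hα.le continuous_const
        (hXY _).continuous_snd hY le_rfl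
    _ = x₀ - M ^ α * A := by
        rw [descent, posPart_of_nonneg hM0, intervalIntegral.integral_mul_const, mul_comm]
    _ < 0 := sub_neg.2 hM

end Shooting

theorem exists_isEmdenFowler_nonneg (ha : IsWeight a) (hb : IsWeight b) (hα : 0 < α) (hβ : 0 < β)
    (hx₀ : 0 ≤ x₀) :
    ∃ m x y, IsEmdenFowler a b α β x₀ m x y ∧ (∀ t, 0 ≤ x t) ∧ ∀ t, 0 ≤ y t := by
  obtain ⟨X, Y, hXY, hX_anti⟩ := exists_isEmdenFowler ha hb hα.le hβ.le x₀
  have hX_cont := continuous_fst_of_antitone ha hb hα hβ hXY hX_anti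
  have hY_cont := continuous_snd_of_continuous_fst ha hb hα.le hβ.le hXY hX_cont
  have hopen : ∀ {Z : ℝ → ℝ → ℝ}, (∀ t, Continuous fun m => Z m t) →
      IsOpen {m | ∃ t, Z m t < 0} := fun hZ => by
    simp only [ofPred_exists]
    exact isOpen_iUnion fun t => isOpen_lt (hZ t) continuous_const
  by_contra! hneg
  obtain ⟨m, -, ⟨S, hS⟩, ⟨t, ht⟩⟩ := isPreconnected_univ {m | ∃ t, X m t < 0} {m | ∃ t, Y m t < 0}
    (hopen hX_cont) (hopen hY_cont)
    (fun m _ => or_iff_not_imp_left.2 fun hx =>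
      hneg m (X m) (Y m) (hXY m) fun t => not_lt.1 fun ht => hx ⟨t, ht⟩)
    ((exists_fst_neg ha hb hα hβ.le hXY).imp fun m hm => ⟨mem_univ m, 1, hm⟩)
    ⟨-1, mem_univ _, 0, by rw [(hXY _).snd_zero]; exact neg_one_lt_zero⟩
  exact ht.not_gt ((hXY m).snd_pos_of_fst_neg ha hb hα hβ hx₀ hS t)

end EmdenFowler

section Existence

variable {d : ℕ} {p q r : ℝ} {u W : ℝ → ℝ}

lemma weightedFlux_of_hasDerivAt (hp : 1 < p) (hr : 0 < r) (hW0 : 0 ≤ W r)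
    (hu : HasDerivAt u (-(W r / r ^ (d - 1)) ^ (1 / (p - 1))) r) : weightedFlux d p u r = W r := by
  have hflux : 0 ≤ W r / r ^ (d - 1) := div_nonneg hW0 (pow_nonneg hr.le _)
  rw [weightedFlux, hu.deriv, abs_neg, abs_of_nonneg (Real.rpow_nonneg hflux _),
    ← Real.rpow_mul hflux, one_div_mul_cancel (sub_pos.2 hp).ne', Real.rpow_one,
    mul_div_cancel₀ _ (pow_pos hr _).ne']

lemma contDiffOn_one_of_hasDerivAt {f f' : ℝ → ℝ} {s : Set ℝ} (hs : IsOpen s)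
    (hf : ∀ x ∈ s, HasDerivAt f (f' x) x) (hf' : ContinuousOn f' s) : ContDiffOn ℝ 1 f s := by
  rw [← zero_add (1 : WithTop ℕ∞), contDiffOn_succ_iff_deriv_of_isOpen hs, contDiffOn_zero]
  exact ⟨fun x hx => (hf x hx).differentiableAt.differentiableWithinAt, by simp,
    hf'.congr fun x hx => (hf x hx).deriv⟩

lemma tendsto_zero_of_hasDerivAt_flux (hq : 0 < q)
    (hW : ∀ r ∈ Ioi 0, HasDerivAt W (-(r ^ (d - 1) * u r ^ q)) r) (hW0 : ∀ r ∈ Ioi 0, 0 ≤ W r)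
    (hu : AntitoneOn u (Ioi 0)) (hu0 : ∀ r ∈ Ioi 0, 0 ≤ u r) : Tendsto u atTop (𝓝 0) := by
  have hpos : ∀ r ∈ Ici (1 : ℝ), r ∈ Ioi (0 : ℝ) := fun r hr => zero_lt_one.trans_le (mem_Ici.1 hr)
  refine tendsto_zero_of_deriv_le_neg_div (fun r hr => hW r (hpos r hr))
    (fun r hr => hW0 r (hpos r hr)) (hu.mono hpos) (fun r hr => hu0 r (hpos r hr))
    fun ε hε => ⟨ε ^ q, Real.rpow_pos_of_pos hε q, fun r hr hεr => ?_⟩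
  rw [neg_div, neg_le_neg_iff]
  calc ε ^ q / r ≤ ε ^ q := div_le_self (Real.rpow_nonneg hε.le q) hr
    _ ≤ u r ^ q := Real.rpow_le_rpow hε.le hεr hq.le
    _ ≤ r ^ (d - 1) * u r ^ q :=
        le_mul_of_one_le_left (Real.rpow_nonneg (hu0 r (hpos r hr)) q) (one_le_pow₀ hr)

theorem isC1NonincreasingSolution_of_hasDerivAt (hp : 1 < p) (hq : 0 < q)
    (hu : ∀ r ∈ Ioi 0, HasDerivAt u (-(W r / r ^ (d - 1)) ^ (1 / (p - 1))) r)
    (hW : ∀ r ∈ Ioi 0, HasDerivAt W (-(r ^ (d - 1) * u r ^ q)) r)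
    (hu0 : ∀ r ∈ Ioi 0, 0 ≤ u r) (hW0 : ∀ r ∈ Ioi 0, 0 ≤ W r)
    (hlim : Tendsto u (𝓝[>] 0) (𝓝 1)) : IsC1NonincreasingSolution d p q u := by
  have hu_cont : ContinuousOn u (Ioi 0) := fun r hr => (hu r hr).continuousAt.continuousWithinAt
  have hW_cont : ContinuousOn W (Ioi 0) := fun r hr => (hW r hr).continuousAt.continuousWithinAt
  have hu'_cont : ContinuousOn (fun r => -(W r / r ^ (d - 1)) ^ (1 / (p - 1))) (Ioi 0) :=
    ((hW_cont.div (continuous_pow _).continuousOn fun r hr => (pow_pos hr _).ne').rpow_const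
      fun r _ => Or.inr (one_div_pos.2 (sub_pos.2 hp)).le).neg
  have hu' : ∀ r ∈ Ioi 0, deriv u r ≤ 0 := fun r hr => by
    rw [(hu r hr).deriv]
    exact neg_nonpos.2 (Real.rpow_nonneg (div_nonneg (hW0 r hr) (pow_nonneg (le_of_lt hr) _)) _)
  have hu_anti : AntitoneOn u (Ioi 0) :=
    antitoneOn_of_deriv_nonpos (convex_Ioi 0) hu_cont
      (by rw [interior_Ioi]; exact fun r hr => (hu r hr).differentiableAt.differentiableWithinAt)
      (by rwa [interior_Ioi])
  refine ⟨contDiffOn_one_of_hasDerivAt isOpen_Ioi hu hu'_cont, hu_anti,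
    (hasWeakDerivOn_neg_weightedFlux_iff hp hu').1 (.of_hasDerivAt isOpen_Ioi (fun r hr => ?_)
      ((continuous_pow _).continuousOn.mul (hu_cont.rpow_const fun _ _ => Or.inr hq.le))),
    hlim, tendsto_zero_of_hasDerivAt_flux hq hW hW0 hu_anti hu0⟩
  rw [← neg_neg (r ^ (d - 1) * u r ^ q)]
  refine (hW r hr).neg.congr_of_eventuallyEq ?_
  filter_upwards [Ioi_mem_nhds hr] with s hs
  exact congrArg Neg.neg (weightedFlux_of_hasDerivAt hp hs (hW0 s hs) (hu s hs))

/-- The weight into which the substitution `t = r^μ` turns `r^{s-1} dr`. For `0 < μ < s` its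
exponent is positive, so that it is continuous even where `r^{s-1}` is singular at `0`. -/
noncomputable def powerWeight (μ s t : ℝ) : ℝ :=
  μ⁻¹ * t⁺ ^ (s / μ - 1)

lemma isWeight_powerWeight {μ s : ℝ} (hμ : 0 < μ) (hs : μ < s) : IsWeight (powerWeight μ s) := by
  have he : 0 < s / μ - 1 := sub_pos.2 ((one_lt_div hμ).2 hs)
  refine ⟨continuous_const.mul (continuous_posPart.rpow_const fun _ => Or.inr he.le),
    fun t ht => ?_, fun t ht => ?_⟩
  · rw [powerWeight, posPart_eq_zero.2 ht, Real.zero_rpow he.ne', mul_zero]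
  · exact mul_pos (inv_pos.2 hμ) (Real.rpow_pos_of_pos (posPart_pos ht) _)

lemma powerWeight_rpow_mul {μ : ℝ} (hμ : μ ≠ 0) (hr : 0 < r) (s : ℝ) :
    powerWeight μ s (r ^ μ) * (μ * r ^ (μ - 1)) = r ^ (s - 1) := by
  calc powerWeight μ s (r ^ μ) * (μ * r ^ (μ - 1))
      = r ^ (μ * (s / μ - 1)) * r ^ (μ - 1) := by
        rw [powerWeight, posPart_of_nonneg (Real.rpow_nonneg hr.le μ), ← Real.rpow_mul hr.le]
        field_simp
    _ = r ^ (s - 1) := by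
        rw [← Real.rpow_add hr]
        congr 1
        field_simp
        ring

lemma hasDerivAt_comp_rpow {μ s v : ℝ} {x : ℝ → ℝ} (hμ : μ ≠ 0) (hr : 0 < r)
    (hx : HasDerivAt x (-(powerWeight μ s (r ^ μ) * v)) (r ^ μ)) :
    HasDerivAt (fun r => x (r ^ μ)) (-(r ^ (s - 1) * v)) r := by
  refine (hx.comp r (Real.hasDerivAt_rpow_const (Or.inl hr.ne'))).congr_deriv ?_
  rw [← powerWeight_rpow_mul hμ hr s]
  ring

lemma div_pow_pred_rpow (hd : 1 ≤ d) (hp : 1 < p) (hr : 0 < r) {w : ℝ} (hw : 0 ≤ w) :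
    (w / r ^ (d - 1)) ^ (1 / (p - 1)) = r ^ ((p - d) / (p - 1) - 1) * w ^ (1 / (p - 1)) := by
  have hp1 : p - 1 ≠ 0 := (sub_pos.2 hp).ne'
  have hexp : ((d : ℝ) - 1) * (1 / (p - 1)) = -((p - d) / (p - 1) - 1) := by
    field_simp
    ring
  rw [pow_pred_eq_rpow hd, Real.div_rpow hw (Real.rpow_nonneg hr.le _), ← Real.rpow_mul hr.le,
    hexp, Real.rpow_neg hr.le, div_inv_eq_mul, mul_comm]

lemma tendsto_comp_rpow_nhdsGT_zero {μ : ℝ} {x : ℝ → ℝ} (hμ : 0 < μ) (hx : Continuous x) :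
    Tendsto (fun r => x (r ^ μ)) (𝓝[>] 0) (𝓝 (x 0)) := by
  have h := (hx.comp (Real.continuous_rpow_const hμ.le)).tendsto 0
  simp only [Function.comp_apply, Real.zero_rpow hμ.ne'] at h
  exact h.mono_left nhdsWithin_le_nhds

theorem exists_isC1NonincreasingSolution (hd : 1 ≤ d) (hp : (d : ℝ) < p) (hq : 0 < q) :
    ∃ u : ℝ → ℝ, IsC1NonincreasingSolution d p q u := by
  have hd1 : (1 : ℝ) ≤ d := by exact_mod_cast hd
  have hp1 : 1 < p := hd1.trans_lt hp
  set θ := (p - d) / (p - 1)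
  have hθ_pos : 0 < θ := div_pos (sub_pos.2 hp) (sub_pos.2 hp1)
  have hθ_le : θ ≤ 1 := (div_le_one (sub_pos.2 hp1)).2 (by linarith)
  have hμ : 0 < θ / 2 := half_pos hθ_pos
  obtain ⟨m, x, y, hxy, hx0, hy0⟩ := exists_isEmdenFowler_nonneg
    (isWeight_powerWeight hμ (half_lt_self hθ_pos))
    (isWeight_powerWeight (s := d) hμ (by linarith)) (one_div_pos.2 (sub_pos.2 hp1)) hq zero_le_one
  refine ⟨fun r => x (r ^ (θ / 2)), isC1NonincreasingSolution_of_hasDerivAt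
    (W := fun r => y (r ^ (θ / 2))) hp1 hq (fun r hr => ?_) (fun r hr => ?_)
    (fun r _ => hx0 _) (fun r _ => hy0 _) ?_⟩
  · refine (hasDerivAt_comp_rpow hμ.ne' hr (hxy.hasDerivAt_fst _)).congr_deriv ?_
    rw [posPart_of_nonneg (hy0 _), div_pow_pred_rpow hd hp1 hr (hy0 _)]
  · refine (hasDerivAt_comp_rpow hμ.ne' hr (hxy.hasDerivAt_snd _)).congr_deriv ?_
    rw [posPart_of_nonneg (hx0 _), pow_pred_eq_rpow hd]
  · exact hxy.fst_zero ▸ tendsto_comp_rpow_nhdsGT_zero hμ hxy.continuous_fst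

end Existence

theorem theorem3p5 (d : ℕ) (hd : 1 ≤ d) (p q : ℝ) (hp : (d : ℝ) < p) (hq : 0 < q) :
    (∃ u : ℝ → ℝ, IsC1NonincreasingSolution d p q u) ∧
    ∀ u : ℝ → ℝ, IsC1NonincreasingSolution d p q u →
      SolvesPointwise d p q u ∧
      (∀ r : ℝ, 0 < r → 0 < u r → deriv u r < 0) ∧
      IntegrableOn (fun r : ℝ => r ^ (d - 1) * |deriv u r| ^ p) (Ioi 0) ∧
      IntegrableOn (fun r : ℝ => r ^ (d - 1) * u r ^ (q + 1)) (Ioi 0) ∧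
      IntegrableOn (fun r : ℝ => r ^ (d - 1) * u r ^ q) (Ioi 0) ∧
      Tendsto (fun r : ℝ => r ^ (d - 1) * |deriv u r| ^ (p - 1)) (𝓝[>] 0)
        (𝓝 (∫ r in Ioi (0 : ℝ), r ^ (d - 1) * u r ^ q)) ∧
      (∫ r in Ioi (0 : ℝ), r ^ (d - 1) * |deriv u r| ^ p)
          + (∫ r in Ioi (0 : ℝ), r ^ (d - 1) * u r ^ (q + 1))
        = ∫ r in Ioi (0 : ℝ), r ^ (d - 1) * u r ^ q := by
  have hp1 : 1 < p := lt_of_le_of_lt (by exact_mod_cast hd) hp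
  refine ⟨exists_isC1NonincreasingSolution hd hp hq, fun u hu => ?_⟩
  obtain ⟨ℓ, hℓ⟩ := hu.exists_tendsto_weightedFlux_zero hp1 hq
  obtain ⟨hsource, rfl⟩ := hu.integrableOn_and_integral_rpow hd hp hq hℓ
  obtain ⟨hgrad, hpot, henergy⟩ := hu.integrableOn_and_integral_energy hd hp hq hℓ
  exact ⟨hu.solvesPointwise hd hp1 hq, fun r hr hur => hu.deriv_neg hp1 hq hr hur, hgrad, hpot,
    hsource, hℓ, henergy⟩
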